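/- Let $X$ be a real or complex Hilbert space and let $M,N$ be closed subspaces of $X$. For Hilbert spaces $H_1,H_2$ (over the same field) $H_1\oplus H_2$ denotes their Hilbert space direct sum, and $\mathrm{Gr}(A)=\{(x,Ax): x\in D(A)\}\subseteq H_1\oplus H_2$ denotes the graph of a linear operator $A:D(A)\to H_2$ with $D(A)\subseteq H_1$. Unordered pairs $\{M,N\}$ of subspaces of $X$ and $\{M',N'\}$ of subspaces of $X'$ are called unitarily equivalent if there is a linear isometry $U$ of $X$ onto $X'$ with $\{U(M),U(N)\}=\{M',N'\}$. A contraction is a bounded linear operator of norm at most $1$, and $\dim$ denotes the Hilbert dimension, i.e. the cardinality of an orthonormal basis. Then the following hold. 1. The following are equivalent: (a) $\{M,N\}$ is in position $p'$, i.e. $M\cap N^{\perp}=M^{\perp}\cap N=\{0\}$. (b) There exist Hilbert spaces $X_1,X_2$ and a contraction $T:X_1\to X_2$ with $I-T^*T$ injective such that $\{M,N\}$ is unitarily equivalent to $\{\mathrm{Gr}(-T),\mathrm{Gr}(T)\}$. (c) There exist Hilbert spaces $Y_1,Y_2$ and a densely defined closed linear operator $S:D(S)\to Y_2$, $D(S)\subseteq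 Y_1$, such that $\{M,N\}$ is unitarily equivalent to $\{Y_1\oplus\{0\},\mathrm{Gr}(S)\}$. 2. The following are equivalent: (a) $\{M,N\}$ is equivalently positioned, i.e. $\dim(M\cap N^{\perp})=\dim(M^{\perp}\cap N)$. (b) There exist Hilbert spaces $X_1,X_2$ and a contraction $T:X_1\to X_2$ such that $\{M,N\}$ is unitarily equivalent to $\{\mathrm{Gr}(-T),\mathrm{Gr}(T)\}$. -/

import Mathlib

universe u

/-- The Hilbert dimension of a Hilbert space `E`: the cardinality of an orthonormal (Hilbert) basis
of `E`. All orthonormal bases have the same cardinality (see `hilbertDim_eq_mk`); we take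
the least one. This differs from the algebraic dimension `Module.rank` in infinite dimensions. -/
noncomputable def hilbertDim (𝕜 : Type*) [RCLike 𝕜] (E : Type u) [NormedAddCommGroup E]
    [InnerProductSpace 𝕜 E] : Cardinal.{u} :=
  sInf {c : Cardinal.{u} | ∃ ι : Type u, Nonempty (HilbertBasis ι 𝕜 E) ∧ Cardinal.mk ι = c}

/-- One half of the invariance of the cardinality of an orthonormal basis. -/
theorem HilbertBasis.mk_le_mk {𝕜 : Type*} [RCLike 𝕜] {E : Type u} [NormedAddCommGroup E]
    [InnerProductSpace 𝕜 E] {ι κ : Type u} (b : HilbertBasis ι 𝕜 E) (c : HilbertBasis κ 𝕜 E) :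
    Cardinal.mk ι ≤ Cardinal.mk κ := by
  classical
  rcases finite_or_infinite κ with hκ | hκ
  · have := Fintype.ofFinite κ
    have hfin : FiniteDimensional 𝕜 E := by
      have := c.toOrthonormalBasis.toBasis
      exact Module.Basis.finiteDimensional_of_finite this
    have h1 := b.orthonormal.linearIndependent.cardinal_le_rank
    have h2 := c.toOrthonormalBasis.toBasis.mk_eq_rank''
    rw [h2]
    exact h1
  · -- every basis vector of `c` is orthogonal to all but countably many vectors of `b`
    have hcount : ∀ k : κ, {i : ι | inner 𝕜 (b i) (c k) ≠ 0}.Countable := by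
      intro k
      have hs := (b.orthonormal.inner_products_summable (x := c k)).countable_support
      refine hs.mono ?_
      intro i hi
      simpa using hi
    have hcover : (⋃ k : κ, {i : ι | inner 𝕜 (b i) (c k) ≠ 0}) = Set.univ := by
      refine Set.eq_univ_of_forall fun i => ?_
      by_contra hcon
      simp only [Set.mem_iUnion, Set.mem_ofPred_eq, not_exists, not_not] at hcon
      have hz : b i = 0 := by
        apply c.repr.injective
        ext k
        rw [c.repr_apply_apply, inner_eq_zero_symm.mp (hcon k)]
        simp
      have := b.orthonormal.1 i
      rw [hz, norm_zero] at this
      exact zero_ne_one this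
    calc Cardinal.mk ι = Cardinal.mk (Set.univ : Set ι) := Cardinal.mk_univ.symm
      _ = Cardinal.mk (⋃ k : κ, {i : ι | inner 𝕜 (b i) (c k) ≠ 0} : Set ι) := by rw [hcover]
      _ ≤ Cardinal.mk κ * ⨆ k : κ, Cardinal.mk {i : ι | inner 𝕜 (b i) (c k) ≠ 0} :=
          Cardinal.mk_iUnion_le _
      _ ≤ Cardinal.mk κ * Cardinal.aleph0 := by
          gcongr
          exact ciSup_le' fun k => (hcount k).le_aleph0
      _ = Cardinal.mk κ := Cardinal.mul_aleph0_eq (Cardinal.aleph0_le_mk κ)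

/-- The Hilbert dimension is the cardinality of any orthonormal basis. -/
theorem hilbertDim_eq_mk {𝕜 : Type*} [RCLike 𝕜] {E : Type u} [NormedAddCommGroup E]
    [InnerProductSpace 𝕜 E] {ι : Type u} (b : HilbertBasis ι 𝕜 E) :
    hilbertDim 𝕜 E = Cardinal.mk ι := by
  refine le_antisymm (csInf_le' ⟨ι, ⟨b⟩, rfl⟩) (le_csInf ⟨_, ι, ⟨b⟩, rfl⟩ ?_)
  rintro _ ⟨κ, ⟨c⟩, rfl⟩
  exact b.mk_le_mk c

/-- The pair of subspaces `M`, `N` is in position `p'`: `M ∩ Nᗮ = Mᗮ ∩ N = {0}`. -/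
def InPositionPPrime {𝕜 : Type*} [RCLike 𝕜] {X : Type*} [NormedAddCommGroup X]
    [InnerProductSpace 𝕜 X] (M N : Submodule 𝕜 X) : Prop :=
  M ⊓ Nᗮ = ⊥ ∧ Mᗮ ⊓ N = ⊥

/-- The pair of subspaces `M`, `N` is equivalently positioned: `dim (M ∩ Nᗮ) = dim (Mᗮ ∩ N)`,
for the Hilbert dimension. -/
def EquivalentlyPositioned {𝕜 : Type*} [RCLike 𝕜] {X : Type u} [NormedAddCommGroup X]
    [InnerProductSpace 𝕜 X] (M N : Submodule 𝕜 X) : Prop :=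
  hilbertDim 𝕜 ↥(M ⊓ Nᗮ) = hilbertDim 𝕜 ↥(Mᗮ ⊓ N)

/-- Unitary equivalence of the unordered pairs `{M, N}` and `{M', N'}`: some isometric
isomorphism of `X` onto `X'` takes the one pair to the other. -/
def UnitarilyEquivalentPairs {𝕜 : Type*} [RCLike 𝕜] {X X' : Type*}
    [NormedAddCommGroup X] [InnerProductSpace 𝕜 X]
    [NormedAddCommGroup X'] [InnerProductSpace 𝕜 X']
    (M N : Submodule 𝕜 X) (M' N' : Submodule 𝕜 X') : Prop :=
  ∃ U : X ≃ₗᵢ[𝕜] X',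
    (M.map U.toLinearEquiv.toLinearMap = M' ∧ N.map U.toLinearEquiv.toLinearMap = N') ∨
    (M.map U.toLinearEquiv.toLinearMap = N' ∧ N.map U.toLinearEquiv.toLinearMap = M')

/-- A subspace of the vector space `E × F`, seen as a subspace of the Hilbert space direct sum
`E ⊕ F`, i.e. of `WithLp 2 (E × F)`. -/
def Submodule.inHilbertSum {𝕜 : Type*} [RCLike 𝕜] {E F : Type*}
    [NormedAddCommGroup E] [InnerProductSpace 𝕜 E]
    [NormedAddCommGroup F] [InnerProductSpace 𝕜 F] (p : Submodule 𝕜 (E × F)) :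
    Submodule 𝕜 (WithLp 2 (E × F)) :=
  p.comap (WithLp.linearEquiv 2 𝕜 (E × F)).toLinearMap

/-- The graph of a bounded operator `T : E → F`, as a subspace of the Hilbert space `E ⊕ F`. -/
def ContinuousLinearMap.hilbertGraph {𝕜 : Type*} [RCLike 𝕜] {E F : Type*}
    [NormedAddCommGroup E] [InnerProductSpace 𝕜 E]
    [NormedAddCommGroup F] [InnerProductSpace 𝕜 F] (T : E →L[𝕜] F) :
    Submodule 𝕜 (WithLp 2 (E × F)) :=
  T.toLinearMap.graph.inHilbertSum

/-- The graph of an operator `S : D(S) → F`, `D(S) ⊆ E`, as a subspace of the Hilbert space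
`E ⊕ F`. -/
def LinearPMap.hilbertGraph {𝕜 : Type*} [RCLike 𝕜] {E F : Type*}
    [NormedAddCommGroup E] [InnerProductSpace 𝕜 E]
    [NormedAddCommGroup F] [InnerProductSpace 𝕜 F] (S : E →ₗ.[𝕜] F) :
    Submodule 𝕜 (WithLp 2 (E × F)) :=
  S.graph.inHilbertSum

/-! The core is the passage from equal dimensions to a contraction. Let `P`, `Q` be the projections
onto `M`, `N` and `A = P + Q - 1`. Then `A P = Q P = Q A`, and `ker A` is the orthogonal sum of `M ⊓
Nᗮ` and `Mᗮ ⊓ N`. Off the kernel, the sign of `A` is a symmetry carrying `M` to `N`; on the kernel,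
equality of dimensions supplies a unitary that swaps the two summands. Glued together they give a
symmetry `J` with `J P = Q J` (`exists_symmetry_exchanging`).

The form `⟨J x, x⟩` is nonnegative on `M`. In the splitting of `X` into the `+1` and `-1`
eigenspaces of `J` this says that the second component of a vector of `M` is dominated by the first,
so `M` is the graph of a contraction `T`, and `N = J M` is the graph of `-T`
(`exists_contraction_of_symmetry`).

Conversely, the reflection `(x, y) ↦ (x, -y)` exchanges the two graphs, so they are equivalently
positioned. Position `p'` is the case where both intersections vanish; for graphs they are copies of
`ker (1 - T*T)`, whence the injectivity condition. For the closed operator, `N` is itself a graph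
over `M` in `M ⊕ Mᗮ`: `Mᗮ ⊓ N = ⊥` makes it single-valued and `M ⊓ Nᗮ = ⊥` makes the domain dense.
-/

/-! ### Square roots and absolute values of self-adjoint contractions -/

/-- The equation `2 Y = C + Y²` has a solution for every `C` in the unit ball, obtained as a norm
limit of polynomials in `C`; then `(1 - Y)² = 1 - C`. -/
theorem exists_two_mul_eq_add_sq (𝕜 : Type*) [RCLike 𝕜] {R : Type*} [NormedRing R]
    [NormOneClass R] [NormedAlgebra 𝕜 R] [CompleteSpace R] [StarRing R] [ContinuousStar R]
    [StarModule 𝕜 R] (C : R) (hC : ‖C‖ ≤ 1) :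
    ∃ Y : R, 2 * Y = C + Y * Y ∧ ‖Y‖ ≤ 1 ∧ (∀ B, Commute B C → Commute B Y) ∧
      (IsSelfAdjoint C → IsSelfAdjoint Y) := by
  let y : ℕ → R := fun n => Nat.rec 0 (fun _ z => (2⁻¹ : 𝕜) • (C + z * z)) n
  -- The scalar recursion with `C` replaced by `1` majorises both the norms and the increments of
  -- `y`; it is bounded by `1`, so the increments are summable by telescoping.
  let r : ℕ → ℝ := fun n => Nat.rec 0 (fun _ z => 2⁻¹ * (1 + z * z)) n
  have hy : ∀ n, y (n + 1) = (2⁻¹ : 𝕜) • (C + y n * y n) := fun n => rfl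
  have hr : ∀ n, r (n + 1) = 2⁻¹ * (1 + r n * r n) := fun n => rfl
  have h2 : ‖(2⁻¹ : 𝕜)‖ = 2⁻¹ := by simp
  have hr0 : ∀ n, 0 ≤ r n ∧ r n ≤ 1 := by
    intro n
    induction n with
    | zero => exact ⟨le_refl _, zero_le_one⟩
    | succ n ih => rw [hr]; constructor <;> nlinarith
  have hyr : ∀ n, ‖y n‖ ≤ r n := by
    intro n
    induction n with
    | zero => simp [y, r]
    | succ n ih =>
      rw [hr, hy, norm_smul, h2]
      have h1 : ‖y n * y n‖ ≤ r n * r n :=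
        (norm_mul_le _ _).trans (mul_le_mul ih ih (norm_nonneg _) (hr0 n).1)
      have := norm_add_le C (y n * y n)
      linarith
  have hd : ∀ n, dist (y n) (y (n + 1)) ≤ r (n + 1) - r n := by
    intro n
    rw [dist_comm, dist_eq_norm]
    induction n with
    | zero =>
      have : y 0 = 0 := rfl
      have h0 : r 0 = 0 := rfl
      rw [this, h0]
      simpa using hyr 1
    | succ n ih =>
      rw [hy (n + 1), hy n, hr (n + 1), ← smul_sub, norm_smul, h2, ← hy n]
      have e : C + y (n + 1) * y (n + 1) - (C + y n * y n) =
          y (n + 1) * (y (n + 1) - y n) + (y (n + 1) - y n) * y n := by noncomm_ring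
      rw [e]
      have h1 : ‖y (n + 1) * (y (n + 1) - y n)‖ ≤ r (n + 1) * (r (n + 1) - r n) :=
        (norm_mul_le _ _).trans (mul_le_mul (hyr (n + 1)) ih (norm_nonneg _) (hr0 (n + 1)).1)
      have h3 : ‖(y (n + 1) - y n) * y n‖ ≤ (r (n + 1) - r n) * r n :=
        (norm_mul_le _ _).trans (mul_le_mul ih (hyr _) (norm_nonneg _) ((norm_nonneg _).trans ih))
      have h4 := norm_add_le (y (n + 1) * (y (n + 1) - y n)) ((y (n + 1) - y n) * y n)
      have h5 := hr n
      nlinarith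
  have hs : Summable fun n => r (n + 1) - r n := by
    refine summable_of_sum_range_le (c := 1) (fun n => dist_nonneg.trans (hd n)) fun n => ?_
    rw [Finset.sum_range_sub]
    have : r 0 = 0 := rfl
    linarith [(hr0 n).2]
  obtain ⟨Y, hY⟩ := cauchySeq_tendsto_of_complete (cauchySeq_of_dist_le_of_summable _ hd hs)
  refine ⟨Y, ?_, ?_, ?_, ?_⟩
  · have h1 := hY.comp (Filter.tendsto_add_atTop_nat 1)
    have h3 : Filter.Tendsto (fun n => (2⁻¹ : 𝕜) • (C + y n * y n)) Filter.atTop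
        (nhds ((2⁻¹ : 𝕜) • (C + Y * Y))) := ((hY.mul hY).const_add C).const_smul _
    have h4 : Y = (2⁻¹ : 𝕜) • (C + Y * Y) := tendsto_nhds_unique h1 h3
    have h5 : (2 : 𝕜) • Y = C + Y * Y := by
      conv_lhs => rw [h4]
      rw [smul_smul, mul_inv_cancel₀ two_ne_zero, one_smul]
    rw [← h5, two_mul, two_smul]
  · exact le_of_tendsto hY.norm (Filter.Eventually.of_forall fun n => (hyr n).trans (hr0 n).2)
  · intro B hB
    have hn : ∀ n, B * y n = y n * B := by
      intro n
      change Commute B (y n)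
      induction n with
      | zero => exact Commute.zero_right B
      | succ n ih => rw [hy]; exact (hB.add_right (ih.mul_right ih)).smul_right _
    refine tendsto_nhds_unique (hY.const_mul B) ?_
    simp_rw [hn]
    exact hY.mul_const B
  · intro hsa
    have hn : ∀ n, star (y n) = y n := by
      intro n
      change IsSelfAdjoint (y n)
      induction n with
      | zero => exact IsSelfAdjoint.zero R
      | succ n ih =>
        rw [hy]
        refine IsSelfAdjoint.smul (by simp [isSelfAdjoint_iff]) (hsa.add ?_)
        rw [isSelfAdjoint_iff, star_mul, ih.star_eq]
    refine tendsto_nhds_unique ?_ hY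
    have := hY.star
    simpa only [hn] using this

section Operators

variable {𝕜 : Type*} [RCLike 𝕜] {E : Type*} [NormedAddCommGroup E] [InnerProductSpace 𝕜 E]

theorem IsSelfAdjoint.inner_left_eq [CompleteSpace E] {A : E →L[𝕜] E} (hA : IsSelfAdjoint A)
    (x y : E) : inner 𝕜 (A x) y = inner 𝕜 x (A y) := by
  conv_lhs => rw [← hA.adjoint_eq]
  exact ContinuousLinearMap.adjoint_inner_left A y x

/-- The absolute value of a self-adjoint contraction, over `ℝ` or `ℂ`. -/
theorem IsSelfAdjoint.exists_abs [CompleteSpace E] {A : E →L[𝕜] E} (hA : IsSelfAdjoint A)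
    (hA1 : ‖A‖ ≤ 1) :
    ∃ S : E →L[𝕜] E, S * S = A * A ∧ IsSelfAdjoint S ∧ (∀ x, 0 ≤ RCLike.re (inner 𝕜 (S x) x)) ∧
      ∀ B, Commute B (A * A) → Commute B S := by
  -- On the zero space `‖1‖ = 0`, so `NormOneClass` fails there.
  rcases subsingleton_or_nontrivial E with hE | hE
  · refine ⟨A, rfl, hA, fun x => ?_, fun B _ => ?_⟩
    · rw [Subsingleton.elim x 0]; simp
    · ext x; exact Subsingleton.elim _ _
  have hC : ‖(1 : E →L[𝕜] E) - A * A‖ ≤ 1 := by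
    refine ContinuousLinearMap.opNorm_le_bound _ zero_le_one fun x => ?_
    have hle : ∀ z, ‖A z‖ ≤ ‖z‖ := fun z => by
      simpa using A.le_of_opNorm_le hA1 z
    have h1 : ‖((1 : E →L[𝕜] E) - A * A) x‖ ^ 2 ≤ ‖x‖ ^ 2 := by
      change ‖x - A (A x)‖ ^ 2 ≤ _
      rw [@norm_sub_sq 𝕜, ← hA.inner_left_eq x (A x), inner_self_eq_norm_sq]
      nlinarith [hle (A x), norm_nonneg (A x), norm_nonneg (A (A x))]
    rw [one_mul]
    exact le_of_sq_le_sq h1 (norm_nonneg _)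
  -- With `C = 1 - A²`, the root is `S = 1 - Y`; it is positive because `‖Y‖ ≤ 1`.
  obtain ⟨Y, hY, hY1, hYc, hYs⟩ := exists_two_mul_eq_add_sq 𝕜 _ hC
  have hYs := hYs ((IsSelfAdjoint.one _).sub (by rw [isSelfAdjoint_iff, star_mul, hA.star_eq]))
  refine ⟨1 - Y, ?_, (IsSelfAdjoint.one _).sub hYs, fun x => ?_, fun B hB => ?_⟩
  · have : (1 - Y) * (1 - Y) = 1 - 2 * Y + Y * Y := by noncomm_ring
    rw [this, hY]; abel
  · change 0 ≤ RCLike.re (inner 𝕜 (x - Y x) x)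
    rw [inner_sub_left, map_sub, inner_self_eq_norm_sq]
    have h1 := re_inner_le_norm (𝕜 := 𝕜) (Y x) x
    have h2 : ‖Y x‖ ≤ ‖x‖ := by simpa using Y.le_of_opNorm_le hY1 x
    nlinarith [norm_nonneg x]
  · exact (Commute.one_right B).sub_right (hYc B ((Commute.one_right B).sub_right hB))

end Operators

/-! ### The symmetry exchanging two subspaces -/

section Symmetry

variable {𝕜 : Type*} [RCLike 𝕜] {X : Type*} [NormedAddCommGroup X] [InnerProductSpace 𝕜 X]
  [CompleteSpace X]

open Submodule

/-- The sign of a self-adjoint operator `A` with absolute value `S`. -/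
theorem exists_sign {A S : X →L[𝕜] X} (hA : IsSelfAdjoint A) (hS : IsSelfAdjoint S)
    (hSS : S * S = A * A) (hAS : A * S = S * A) :
    ∃ J : X →L[𝕜] X, IsSelfAdjoint J ∧ J * J = 1 ∧ A * J = S ∧ ∀ x, A x = 0 → J x = x := by
  let G : Submodule 𝕜 X := (A - S).ker
  have : CompleteSpace G := (ContinuousLinearMap.isClosed_ker (A - S)).completeSpace_coe
  have hG : ∀ x, x ∈ G ↔ A x = S x := fun x => by
    change (A - S) x = 0 ↔ _
    rw [sub_apply, sub_eq_zero]
  have hAS' : ∀ x, A (S x) = S (A x) := fun x => DFunLike.congr_fun hAS x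
  have hSS' : ∀ x, S (S x) = A (A x) := fun x => DFunLike.congr_fun hSS x
  -- Since `(A - S)(A + S) = 0`, the range of `A + S` lies in `G`, so `A = S` on `G` and `A = -S` on
  -- `Gᗮ`. The sign is therefore the reflection in `G`, which contains `ker A`.
  have hGG : ∀ y, A y + S y ∈ G := fun y => by
    rw [hG, map_add, map_add, hAS', hSS', add_comm]
  have hzero : ∀ y ∈ Gᗮ, A y + S y = 0 := by
    intro y hy
    refine inner_self_eq_zero.1 ((?_ : inner 𝕜 (A y + S y) (A y + S y) = 0))
    have h1 : ∀ w, inner 𝕜 (A y + S y) w = inner 𝕜 y (A w + S w) := fun w => by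
      rw [inner_add_left, inner_add_right, hA.inner_left_eq, hS.inner_left_eq]
    rw [h1]
    exact inner_left_of_mem_orthogonal (hGG _) hy
  have hPs : IsSelfAdjoint G.starProjection := isSelfAdjoint_starProjection G
  have hPP : G.starProjection * G.starProjection = G.starProjection :=
    (isIdempotentElem_starProjection G)
  refine ⟨2 * G.starProjection - 1, ?_, ?_, ?_, ?_⟩
  · rw [two_mul]
    exact (hPs.add hPs).sub (IsSelfAdjoint.one _)
  · have : (2 * G.starProjection - 1) * (2 * G.starProjection - 1) =
        4 * (G.starProjection * G.starProjection) - 4 * G.starProjection + 1 := by noncomm_ring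
    rw [this, hPP]; simp
  · ext x
    have h1 := hzero _ (G.sub_starProjection_mem_orthogonal x)
    have h2 := (hG _).1 (G.starProjection_apply_mem x)
    rw [two_mul]
    change A (G.starProjection x + G.starProjection x - x) = S x
    simp only [map_add, map_sub] at h1 ⊢
    have h3 : S x = -(A x - A (G.starProjection x) - S (G.starProjection x)) := by
      rw [eq_neg_iff_add_eq_zero, ← h1]; abel
    rw [h3, ← h2]; abel
  · intro x hx
    have hSx : S x = 0 := by
      refine (inner_self_eq_zero (𝕜 := 𝕜)).1 ?_
      rw [hS.inner_left_eq, hSS', hx]; simp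
    have : G.starProjection x = x := starProjection_eq_self_iff.2 ((hG x).2 (hx.trans hSx.symm))
    rw [two_mul]
    change G.starProjection x + G.starProjection x - x = x
    rw [this]; abel

/-- The partial isometry with initial space `M ⊓ Nᗮ` and final space `Mᗮ ⊓ N`. -/
theorem exists_partialIsometry (M N : Submodule 𝕜 X) [M.HasOrthogonalProjection]
    [N.HasOrthogonalProjection] (V : ↥(M ⊓ Nᗮ) ≃ₗᵢ[𝕜] ↥(Mᗮ ⊓ N))
    [CompleteSpace ↥(M ⊓ Nᗮ)] [CompleteSpace ↥(Mᗮ ⊓ N)] :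
    ∃ U : X →L[𝕜] X, M.starProjection * U = 0 ∧ N.starProjection * U = U ∧
      M.starProjection * star U = star U ∧ N.starProjection * star U = 0 ∧
      (∀ k ∈ M ⊓ Nᗮ, star U (U k) = k) ∧ ∀ k ∈ Mᗮ ⊓ N, U (star U k) = k := by
  let K₁ : Submodule 𝕜 X := M ⊓ Nᗮ
  let K₂ : Submodule 𝕜 X := Mᗮ ⊓ N
  obtain ⟨U, hUdef⟩ : ∃ U : X →L[𝕜] X, U = K₂.subtypeL ∘L
      (V.toContinuousLinearEquiv : K₁ →L[𝕜] K₂) ∘L K₁.orthogonalProjectionOnto := ⟨_, rfl⟩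
  have hUapp : ∀ x, U x = (V (K₁.orthogonalProjectionOnto x) : X) := fun x => by rw [hUdef]; rfl
  have hUstar : ∀ x, star U x = (V.symm (K₂.orthogonalProjectionOnto x) : X) := by
    intro x
    refine ext_inner_right 𝕜 fun z => ?_
    rw [ContinuousLinearMap.star_eq_adjoint, ContinuousLinearMap.adjoint_inner_left, hUapp]
    rw [← K₂.inner_orthogonalProjectionOnto_eq_of_mem_right,
      ← K₁.inner_orthogonalProjectionOnto_eq_of_mem_left, ← V.inner_map_map, V.apply_symm_apply]
  refine ⟨U, ?_, ?_, ?_, ?_, ?_, ?_⟩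
  · ext x
    change M.starProjection (U x) = 0
    rw [hUapp]
    exact (starProjection_apply_eq_zero_iff _).2 (V _).2.1
  · ext x
    change N.starProjection (U x) = U x
    rw [hUapp]
    exact starProjection_eq_self_iff.2 (V _).2.2
  · ext x
    change M.starProjection (star U x) = star U x
    rw [hUstar]
    exact starProjection_eq_self_iff.2 (V.symm _).2.1
  · ext x
    change N.starProjection (star U x) = 0
    rw [hUstar]
    exact (starProjection_apply_eq_zero_iff _).2 (V.symm _).2.2
  · intro k hk
    rw [hUstar, hUapp, orthogonalProjectionOnto_mem_subspace_eq_self, V.symm_apply_apply]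
    exact starProjection_eq_self_iff.2 hk
  · intro k hk
    rw [hUapp, hUstar, orthogonalProjectionOnto_mem_subspace_eq_self, V.apply_symm_apply]
    exact starProjection_eq_self_iff.2 hk

/-- The form of `H` sees only the component `y` of `x` orthogonal to `ker H`. As `(H - S) y` lies in
`ker H`, it is orthogonal to `y`, so `⟨H x, x⟩ = ⟨S y, y⟩`. -/
theorem IsSelfAdjoint.re_inner_nonneg_of_mul_sub_eq_zero {H S : X →L[𝕜] X} (hHs : IsSelfAdjoint H)
    (hSpos : ∀ x, 0 ≤ RCLike.re (inner 𝕜 (S x) x)) (hHS : H * (H - S) = 0) (x : X) :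
    0 ≤ RCLike.re (inner 𝕜 (H x) x) := by
  have hHS' : ∀ y, H (H y - S y) = 0 := fun y => DFunLike.congr_fun hHS y
  let Z : Submodule 𝕜 X := H.ker
  have : CompleteSpace Z := (ContinuousLinearMap.isClosed_ker H).completeSpace_coe
  have hk : H (Z.starProjection x) = 0 := Z.starProjection_apply_mem x
  have hy := Z.sub_starProjection_mem_orthogonal x
  set y := x - Z.starProjection x with hydef
  have hHx : H x = H y := by rw [hydef, map_sub, hk, sub_zero]
  have e2 : inner 𝕜 (H x) x = inner 𝕜 (H y) y := by
    rw [hHx, hHs.inner_left_eq, hHx, ← hHs.inner_left_eq]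
  have e3 : inner 𝕜 (H y - S y) y = 0 := inner_right_of_mem_orthogonal (hHS' y) hy
  rw [inner_sub_left, sub_eq_zero] at e3
  rw [e2, e3]
  exact hSpos y

set_option maxHeartbeats 800000 in
/-- A symmetry that exchanges two equivalently positioned subspaces. -/
theorem exists_symmetry_exchanging (M N : Submodule 𝕜 X) [M.HasOrthogonalProjection]
    [N.HasOrthogonalProjection] (V : ↥(M ⊓ Nᗮ) ≃ₗᵢ[𝕜] ↥(Mᗮ ⊓ N))
    [CompleteSpace ↥(M ⊓ Nᗮ)] [CompleteSpace ↥(Mᗮ ⊓ N)] :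
    ∃ J : X →L[𝕜] X, IsSelfAdjoint J ∧ J * J = 1 ∧
      J * M.starProjection = N.starProjection * J ∧
      (∀ x ∈ M, 0 ≤ RCLike.re (inner 𝕜 (J x) x)) ∧
      ∀ y, y ∈ Mᗮ → y ∈ Nᗮ → J y = y → y = 0 := by
  set P := M.starProjection with hPdef
  set Q := N.starProjection with hQdef
  have hPs : IsSelfAdjoint P := isSelfAdjoint_starProjection M
  have hQs : IsSelfAdjoint Q := isSelfAdjoint_starProjection N
  have hPP : P * P = P := isIdempotentElem_starProjection M
  have hQQ : Q * Q = Q := isIdempotentElem_starProjection N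
  obtain ⟨A, hAdef⟩ : ∃ A, A = P + Q - 1 := ⟨_, rfl⟩
  have hAs : IsSelfAdjoint A := by rw [hAdef]; exact (hPs.add hQs).sub (IsSelfAdjoint.one _)
  have hA1 : ‖A‖ ≤ 1 := by
    refine ContinuousLinearMap.opNorm_le_bound _ zero_le_one fun x => ?_
    -- `2 A` is a sum of two reflections, which are isometries.
    have h1 : (2 : 𝕜) • A x = M.reflection x + N.reflection x := by
      rw [reflection_apply, reflection_apply, hAdef]
      change (2 : 𝕜) • (P x + Q x - x) = _
      simp only [two_smul, ← hPdef, ← hQdef]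
      abel
    have h2 : 2 * ‖A x‖ ≤ ‖x‖ + ‖x‖ := by
      calc 2 * ‖A x‖ = ‖(2 : 𝕜) • A x‖ := by rw [norm_smul]; simp
        _ ≤ _ := by
          rw [h1]
          refine (norm_add_le _ _).trans ?_
          rw [LinearIsometryEquiv.norm_map, LinearIsometryEquiv.norm_map]
    linarith
  have hAP : A * P = Q * P := by rw [hAdef, sub_mul, add_mul, hPP]; noncomm_ring
  have hAQ : A * Q = P * Q := by rw [hAdef, sub_mul, add_mul, hQQ]; noncomm_ring
  have hPA : P * A = P * Q := by rw [hAdef, mul_sub, mul_add, hPP]; noncomm_ring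
  have hQA : Q * A = Q * P := by rw [hAdef, mul_sub, mul_add, hQQ]; noncomm_ring
  obtain ⟨S, hSS, hSs, hSpos, hSc⟩ := hAs.exists_abs hA1
  have hSP : P * S = S * P := hSc P (by
    change P * (A * A) = A * A * P
    rw [← mul_assoc, hPA, mul_assoc, hQA, mul_assoc A, hAP, ← mul_assoc A, hAQ, mul_assoc])
  have hSA : A * S = S * A := hSc A (by
    change A * (A * A) = A * A * A
    rw [mul_assoc])
  obtain ⟨J₀, hJs, hJJ, hAJ, hJfix⟩ := exists_sign hAs hSs hSS hSA
  obtain ⟨U, hPU, hQU, hPU', hQU', e1, e2⟩ := exists_partialIsometry M N V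
  rw [← hPdef] at hPU hPU'
  rw [← hQdef] at hQU hQU'
  have hUP : U * P = U := by
    have := congrArg star hPU'
    rwa [star_mul, star_star, hPs.star_eq] at this
  have hUQ : U * Q = 0 := by
    have := congrArg star hQU'
    rwa [star_mul, star_star, hQs.star_eq, star_zero] at this
  have hU'P : star U * P = 0 := by
    have := congrArg star hPU
    rwa [star_mul, hPs.star_eq, star_zero] at this
  have hU'Q : star U * Q = star U := by
    have := congrArg star hQU
    rwa [star_mul, hQs.star_eq] at this
  have hUU : U * U = 0 := by
    nth_rw 1 [← hUP]
    rw [mul_assoc, hPU, mul_zero]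
  have hUU' : star U * star U = 0 := by
    have := congrArg star hUU
    rwa [star_mul, star_zero] at this
  have hAU : A * U = 0 := by rw [hAdef, sub_mul, add_mul, hPU, hQU]; simp
  have hAU' : A * star U = 0 := by rw [hAdef, sub_mul, add_mul, hPU', hQU']; simp
  have hJfix' : ∀ B : X →L[𝕜] X, A * B = 0 → J₀ * B = B := fun B hB => by
    ext x
    exact hJfix _ (DFunLike.congr_fun hB x)
  -- the projection `L` onto `ker A`, and the symmetry `W` of `ker A`
  obtain ⟨L, hLdef⟩ : ∃ L, L = star U * U + U * star U := ⟨_, rfl⟩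
  obtain ⟨W, hWdef⟩ : ∃ W, W = U + star U := ⟨_, rfl⟩
  have hLs : star L = L := by rw [hLdef]; simp
  have hWs : star W = W := by rw [hWdef]; simp [add_comm]
  have hAL : A * L = 0 := by
    rw [hLdef, mul_add, ← mul_assoc, ← mul_assoc, hAU, hAU', zero_mul, zero_mul, zero_add]
  have hAW : A * W = 0 := by rw [hWdef, mul_add, hAU, hAU', zero_add]
  have hLfix : ∀ x, A x = 0 → L x = x := by
    -- On `ker A` one has `x = P x + Q x`, and `Q P = Q A`, `P Q = P A` place the two terms in `M ⊓
    -- Nᗮ` and `Mᗮ ⊓ N`.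
    intro x hx
    have h1 : Q (P x) = 0 := by
      have : A (P x) = Q (A x) := DFunLike.congr_fun (hAP.trans hQA.symm) x
      have h2 : A (P x) = Q (P x) := DFunLike.congr_fun hAP x
      rw [← h2, this, hx, map_zero]
    have h1' : P (Q x) = 0 := by
      have : A (Q x) = P (A x) := DFunLike.congr_fun (hAQ.trans hPA.symm) x
      have h2 : A (Q x) = P (Q x) := DFunLike.congr_fun hAQ x
      rw [← h2, this, hx, map_zero]
    have h3 : x = P x + Q x := by
      rw [hAdef] at hx
      exact (sub_eq_zero.1 hx).symm
    have hk1 : P x ∈ M ⊓ Nᗮ :=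
      ⟨M.starProjection_apply_mem x, (starProjection_apply_eq_zero_iff _).1 h1⟩
    have hk2 : Q x ∈ Mᗮ ⊓ N :=
      ⟨(starProjection_apply_eq_zero_iff _).1 h1', N.starProjection_apply_mem x⟩
    have e3 : U (Q x) = 0 := DFunLike.congr_fun hUQ x
    have e4 : star U (P x) = 0 := DFunLike.congr_fun hU'P x
    have e5 : U x = U (P x) := by conv_lhs => rw [h3, map_add, e3, add_zero]
    have e6 : star U x = star U (Q x) := by conv_lhs => rw [h3, map_add, e4, zero_add]
    rw [hLdef]
    change star U (U x) + U (star U x) = x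
    rw [e5, e6, e1 _ hk1, e2 _ hk2, ← h3]
  have hLfix' : ∀ B : X →L[𝕜] X, A * B = 0 → L * B = B := fun B hB => by
    ext x
    exact hLfix _ (DFunLike.congr_fun hB x)
  have hJL : J₀ * L = L := hJfix' _ hAL
  have hJW : J₀ * W = W := hJfix' _ hAW
  have hLJ : L * J₀ = L := by
    have := congrArg star hJL
    rwa [star_mul, hLs, hJs.star_eq] at this
  have hWJ : W * J₀ = W := by
    have := congrArg star hJW
    rwa [star_mul, hWs, hJs.star_eq] at this
  have hLL : L * L = L := hLfix' _ hAL
  have hLW : L * W = W := hLfix' _ hAW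
  have hWL : W * L = W := by
    have := congrArg star hLW
    rwa [star_mul, hWs, hLs] at this
  have hWW : W * W = L := by
    rw [hWdef, hLdef, mul_add, add_mul, add_mul, hUU, hUU', zero_add, add_zero]
  have hQL : Q * L = L * Q := by
    rw [hLdef, mul_add, add_mul, mul_assoc, mul_assoc, hUQ, hU'Q, ← mul_assoc, ← mul_assoc, hQU,
      hQU', zero_mul, mul_zero]
  have hWPQ : W * P = Q * W := by
    rw [hWdef, add_mul, mul_add, hUP, hU'P, hQU, hQU']
  -- `J₀` is the identity on `ker A`; there it is replaced by the swap `W`.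
  obtain ⟨J, hJdef⟩ : ∃ J, J = J₀ - L + W := ⟨_, rfl⟩
  have hJ2 : J * J = 1 := by
    have : (J₀ - L + W) * (J₀ - L + W) = J₀ * J₀ - J₀ * L + J₀ * W - L * J₀ + L * L - L * W +
        W * J₀ - W * L + W * W := by noncomm_ring
    rw [hJdef, this, hJJ, hJL, hJW, hLJ, hLL, hLW, hWJ, hWL, hWW]; abel
  have hJsa : IsSelfAdjoint J := by
    rw [hJdef, isSelfAdjoint_iff, star_add, star_sub, hJs.star_eq, hLs, hWs]
  have hJPQ : J * P = Q * J := by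
    -- The failure of `J₀` to intertwine `P` and `Q` takes values in `ker A`, so `L` fixes it and it
    -- equals `L P - Q L`. Subtracting `L` in `J` cancels exactly this.
    have hD : A * (J₀ * P - Q * J₀) = 0 := by
      rw [mul_sub, ← mul_assoc, ← mul_assoc, hAJ, hAQ, ← hPA, mul_assoc P, hAJ, hSP, sub_self]
    have := hLfix' _ hD
    rw [mul_sub, ← mul_assoc, ← mul_assoc, hLJ, ← hQL, mul_assoc Q, hLJ] at this
    have h2 : J * P - Q * J = (J₀ * P - Q * J₀) - (L * P - Q * L) + (W * P - Q * W) := by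
      rw [hJdef]; noncomm_ring
    rw [← sub_eq_zero, h2, ← this, hWPQ]; simp
  have hAJ' : A * J = S := by rw [hJdef, mul_add, mul_sub, hAJ, hAL, hAW]; simp
  have hSJ : S * J = A := by rw [← hAJ', mul_assoc, hJ2, mul_one]
  have hJS : J * S = A := by
    have := congrArg star hSJ
    rwa [star_mul, hJsa.star_eq, hSs.star_eq, hAs.star_eq] at this
  refine ⟨J, hJsa, hJ2, hJPQ, ?_, ?_⟩
  · intro x hx
    -- The compression of `J` to `M` satisfies `H² = P Q P = H S`, so it inherits positivity from
    -- `S`.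
    obtain ⟨H, hHdef⟩ : ∃ H, H = P * J * P := ⟨_, rfl⟩
    have hHs : IsSelfAdjoint H := by
      rw [hHdef, isSelfAdjoint_iff, star_mul, star_mul, hPs.star_eq, hJsa.star_eq, mul_assoc]
    have hHS : H * (H - S) = 0 := by
      have e1 : H * H = P * Q * P := by
        have : H * H = P * (J * P) * P * J * P := by
          rw [hHdef]
          calc P * J * P * (P * J * P) = P * J * (P * P) * J * P := by noncomm_ring
            _ = _ := by rw [hPP]; rw [mul_assoc P (J * P), mul_assoc J, hPP]; noncomm_ring
        rw [this, mul_assoc P (J * P), mul_assoc J, hPP, hJPQ, ← mul_assoc P, mul_assoc (P * Q), hJ2,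
          mul_one]
      have e2 : H * S = P * Q * P := by
        rw [hHdef, mul_assoc, hSP, mul_assoc, ← mul_assoc J, hJS, ← mul_assoc, hPA]
      rw [mul_sub, e1, e2, sub_self]
    have hx' : P x = x := starProjection_eq_self_iff.2 hx
    have e : inner 𝕜 (J x) x = inner 𝕜 (H x) x := by
      rw [hHdef]
      change _ = inner 𝕜 (P (J (P x))) x
      rw [hPs.inner_left_eq, hx']
    rw [e]
    exact hHs.re_inner_nonneg_of_mul_sub_eq_zero hSpos hHS x
  · intro y hyM hyN hJy
    have h1 : P y = 0 := (starProjection_apply_eq_zero_iff _).2 hyM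
    have h2 : Q y = 0 := (starProjection_apply_eq_zero_iff _).2 hyN
    -- `S y = S J y = A y`, and `A = -1` on `Mᗮ ⊓ Nᗮ`; this contradicts `S ≥ 0` unless `y = 0`.
    have h3 : S y = -y := by
      have : S (J y) = A y := DFunLike.congr_fun hSJ y
      rw [hJy, hAdef] at this
      rw [this]
      change P y + Q y - y = -y
      rw [h1, h2]; simp
    have h4 := hSpos y
    rw [h3, inner_neg_left, map_neg, inner_self_eq_norm_sq] at h4
    have : ‖y‖ = 0 := by nlinarith [norm_nonneg y]
    exact norm_eq_zero.1 this

end Symmetry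

/-! ### Relative position of graphs -/

section Graphs

variable {𝕜 : Type*} [RCLike 𝕜] {E F : Type*} [NormedAddCommGroup E] [InnerProductSpace 𝕜 E]
  [NormedAddCommGroup F] [InnerProductSpace 𝕜 F]

theorem ContinuousLinearMap.mem_hilbertGraph {T : E →L[𝕜] F} {w : WithLp 2 (E × F)} :
    w ∈ T.hilbertGraph ↔ w.snd = T w.fst := Iff.rfl

theorem LinearPMap.mem_hilbertGraph {S : E →ₗ.[𝕜] F} {w : WithLp 2 (E × F)} :
    w ∈ S.hilbertGraph ↔ (w.fst, w.snd) ∈ S.graph := Iff.rfl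

/-- Pairing `(z, T z)` with `(x, -T x)` gives `⟨z, (1 - T*T) x⟩`. -/
theorem mem_hilbertGraph_neg_inf_orthogonal_iff [CompleteSpace E] [CompleteSpace F]
    (T : E →L[𝕜] F) {w : WithLp 2 (E × F)} :
    w ∈ (-T).hilbertGraph ⊓ T.hilbertGraphᗮ ↔ w.snd = -T w.fst ∧
      (ContinuousLinearMap.id 𝕜 E - ContinuousLinearMap.adjoint T ∘L T) w.fst = 0 := by
  rw [Submodule.mem_inf, ContinuousLinearMap.mem_hilbertGraph]
  refine and_congr_right fun h => ?_
  replace h : w.snd = -T w.fst := h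
  have key : ∀ z : E, inner 𝕜 z w.fst + inner 𝕜 (T z) w.snd = inner 𝕜 z
      ((ContinuousLinearMap.id 𝕜 E - ContinuousLinearMap.adjoint T ∘L T) w.fst) := fun z => by
    rw [h]
    change _ = inner 𝕜 z (w.fst - ContinuousLinearMap.adjoint T (T w.fst))
    rw [inner_sub_right, ContinuousLinearMap.adjoint_inner_right, inner_neg_right, sub_eq_add_neg]
  rw [Submodule.mem_orthogonal]
  constructor
  · intro h1
    refine ext_inner_left 𝕜 fun z => ?_
    rw [← key, inner_zero_right]
    exact h1 (WithLp.toLp 2 (z, T z)) (ContinuousLinearMap.mem_hilbertGraph.2 rfl)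
  · intro h1 v hv
    have hv : v.snd = T v.fst := hv
    have := key v.fst
    rw [h1, inner_zero_right, ← hv] at this
    exact this

theorem inPositionPPrime_hilbertGraph_iff [CompleteSpace E] [CompleteSpace F] (T : E →L[𝕜] F) :
    InPositionPPrime (-T).hilbertGraph T.hilbertGraph ↔
      Function.Injective (ContinuousLinearMap.id 𝕜 E - ContinuousLinearMap.adjoint T ∘L T) := by
  rw [injective_iff_map_eq_zero]
  constructor
  · rintro ⟨h, -⟩ x hx
    have : WithLp.toLp 2 (x, -T x) ∈ (-T).hilbertGraph ⊓ T.hilbertGraphᗮ :=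
      (mem_hilbertGraph_neg_inf_orthogonal_iff T).2 ⟨rfl, hx⟩
    rw [h, Submodule.mem_bot] at this
    exact congrArg WithLp.fst this
  · intro h
    have aux : ∀ R : E →L[𝕜] F, (∀ x, (ContinuousLinearMap.id 𝕜 E -
        ContinuousLinearMap.adjoint R ∘L R) x = 0 → x = 0) →
        (-R).hilbertGraph ⊓ R.hilbertGraphᗮ = ⊥ := fun R hR => by
      rw [Submodule.eq_bot_iff]
      intro w hw
      obtain ⟨h1, h2⟩ := (mem_hilbertGraph_neg_inf_orthogonal_iff R).1 hw
      have h3 := hR _ h2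
      rw [h3, map_zero, neg_zero] at h1
      exact WithLp.ofLp_injective 2 (Prod.ext h3 h1)
    refine ⟨aux T h, ?_⟩
    -- `1 - T*T` is even in `T`, so the other intersection is the same statement for `-T`.
    have := aux (-T) fun x hx => h x (by simpa using hx)
    rwa [neg_neg, inf_comm] at this

/-- A vector `(y, 0)` orthogonal to the graph has `y` orthogonal to the domain; a vector `(0, z)` in
the graph vanishes by single-valuedness. -/
theorem inPositionPPrime_prod_top_bot_hilbertGraph {S : E →ₗ.[𝕜] F}
    (hS : Dense (S.domain : Set E)) :
    InPositionPPrime (Submodule.prod (⊤ : Submodule 𝕜 E) (⊥ : Submodule 𝕜 F)).inHilbertSum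
      S.hilbertGraph := by
  constructor
  · rw [Submodule.eq_bot_iff]
    rintro w ⟨⟨-, h1⟩, h2⟩
    replace h1 : w.snd = 0 := h1
    have h3 : w.fst = 0 := by
      refine hS.eq_zero_of_inner_right 𝕜 fun x hx => ?_
      have := (Submodule.mem_orthogonal _ _).1 h2 (WithLp.toLp 2 (x, S ⟨x, hx⟩))
        (S.mem_graph ⟨x, hx⟩)
      have e : inner 𝕜 x w.fst + inner 𝕜 (S ⟨x, hx⟩) w.snd = 0 := this
      rwa [h1, inner_zero_right, add_zero] at e
    exact WithLp.ofLp_injective 2 (Prod.ext h3 h1)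
  · rw [Submodule.eq_bot_iff]
    rintro w ⟨h1, h2⟩
    have h3 : w.fst = 0 := by
      have := (Submodule.mem_orthogonal _ _).1 h1 (WithLp.toLp 2 (w.fst, 0)) ⟨trivial, rfl⟩
      have e : inner 𝕜 w.fst w.fst + inner 𝕜 (0 : F) w.snd = 0 := this
      rwa [inner_zero_left, add_zero, inner_self_eq_zero] at e
    have h4 : w.snd = 0 := S.graph_fst_eq_zero_snd h2 h3
    exact WithLp.ofLp_injective 2 (Prod.ext h3 h4)

end Graphs

/-! ### Invariance under unitary equivalence, and Hilbert dimension -/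

section Equivalence

variable {𝕜 : Type*} [RCLike 𝕜]

theorem Submodule.orthogonal_map_linearIsometryEquiv {X X' : Type*} [NormedAddCommGroup X]
    [InnerProductSpace 𝕜 X] [NormedAddCommGroup X'] [InnerProductSpace 𝕜 X'] (U : X ≃ₗᵢ[𝕜] X')
    (K : Submodule 𝕜 X) :
    (K.map U.toLinearEquiv.toLinearMap)ᗮ = Kᗮ.map U.toLinearEquiv.toLinearMap := by
  ext y
  obtain ⟨x, rfl⟩ := U.surjective y
  constructor
  · intro h
    refine ⟨x, (K.mem_orthogonal x).2 fun u hu => ?_, rfl⟩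
    rw [← U.inner_map_map]
    exact (Submodule.mem_orthogonal _ _).1 h _ ⟨u, hu, rfl⟩
  · rintro ⟨z, hz, hzx⟩
    obtain rfl : z = x := U.injective hzx
    rw [Submodule.mem_orthogonal]
    rintro _ ⟨u, hu, rfl⟩
    exact (U.inner_map_map u z).trans ((K.mem_orthogonal z).1 hz u hu)

theorem Submodule.map_inf_orthogonal_linearIsometryEquiv {X X' : Type*} [NormedAddCommGroup X]
    [InnerProductSpace 𝕜 X] [NormedAddCommGroup X'] [InnerProductSpace 𝕜 X'] (U : X ≃ₗᵢ[𝕜] X')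
    (K L : Submodule 𝕜 X) :
    (K ⊓ Lᗮ).map U.toLinearEquiv.toLinearMap =
      K.map U.toLinearEquiv.toLinearMap ⊓ (L.map U.toLinearEquiv.toLinearMap)ᗮ := by
  rw [Submodule.map_inf _ U.injective, orthogonal_map_linearIsometryEquiv]

theorem InPositionPPrime.symm {X : Type*} [NormedAddCommGroup X] [InnerProductSpace 𝕜 X]
    {M N : Submodule 𝕜 X} (h : InPositionPPrime M N) : InPositionPPrime N M :=
  ⟨by rw [inf_comm]; exact h.2, by rw [inf_comm]; exact h.1⟩

theorem UnitarilyEquivalentPairs.inPositionPPrime_iff {X X' : Type*} [NormedAddCommGroup X]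
    [InnerProductSpace 𝕜 X] [NormedAddCommGroup X'] [InnerProductSpace 𝕜 X']
    {M N : Submodule 𝕜 X} {M' N' : Submodule 𝕜 X'} (h : UnitarilyEquivalentPairs M N M' N') :
    InPositionPPrime M N ↔ InPositionPPrime M' N' := by
  obtain ⟨U, h⟩ := h
  have key : InPositionPPrime M N ↔ InPositionPPrime (M.map U.toLinearEquiv.toLinearMap)
      (N.map U.toLinearEquiv.toLinearMap) := by
    unfold InPositionPPrime
    rw [inf_comm Mᗮ, inf_comm (M.map _)ᗮ, ← Submodule.map_inf_orthogonal_linearIsometryEquiv,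
      ← Submodule.map_inf_orthogonal_linearIsometryEquiv]
    have hU : ∀ K : Submodule 𝕜 X, K.map U.toLinearEquiv.toLinearMap = ⊥ ↔ K = ⊥ := fun K =>
      Submodule.map_eq_bot_iff (e := U.toLinearEquiv) (p := K)
    rw [hU, hU]
  rw [key]
  rcases h with ⟨h1, h2⟩ | ⟨h1, h2⟩
  · rw [h1, h2]
  · rw [h1, h2]
    exact ⟨InPositionPPrime.symm, InPositionPPrime.symm⟩

/-- Matching orthonormal bases turns the equality of cardinals into the unitary needed to swap the
two parts of `ker A`. -/
theorem hilbertDim_eq_iff {E F : Type u} [NormedAddCommGroup E] [InnerProductSpace 𝕜 E]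
    [CompleteSpace E] [NormedAddCommGroup F] [InnerProductSpace 𝕜 F] [CompleteSpace F] :
    hilbertDim 𝕜 E = hilbertDim 𝕜 F ↔ Nonempty (E ≃ₗᵢ[𝕜] F) := by
  obtain ⟨s, b, -⟩ := exists_hilbertBasis 𝕜 E
  obtain ⟨t, c, -⟩ := exists_hilbertBasis 𝕜 F
  constructor
  · intro h
    rw [hilbertDim_eq_mk b, hilbertDim_eq_mk c] at h
    obtain ⟨e⟩ := Cardinal.eq.1 h
    let c' : HilbertBasis s 𝕜 F := HilbertBasis.mk (c.orthonormal.comp e e.injective) (by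
      rw [Set.range_comp, e.range_eq_univ, Set.image_univ, c.dense_span])
    exact ⟨b.repr.trans c'.repr.symm⟩
  · rintro ⟨U⟩
    rw [hilbertDim_eq_mk b]
    exact (hilbertDim_eq_mk (HilbertBasis.ofRepr (U.symm.trans b.repr))).symm

theorem EquivalentlyPositioned.symm {X : Type u} [NormedAddCommGroup X] [InnerProductSpace 𝕜 X]
    {M N : Submodule 𝕜 X} (h : EquivalentlyPositioned M N) : EquivalentlyPositioned N M := by
  unfold EquivalentlyPositioned at h ⊢
  rw [inf_comm N, inf_comm Nᗮ]
  exact h.symm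

theorem InPositionPPrime.equivalentlyPositioned {X : Type u} [NormedAddCommGroup X]
    [InnerProductSpace 𝕜 X] {M N : Submodule 𝕜 X} (h : InPositionPPrime M N) :
    EquivalentlyPositioned M N := by
  unfold EquivalentlyPositioned
  rw [h.1, h.2]

theorem Submodule.hilbertDim_map_linearIsometryEquiv {X X' : Type u} [NormedAddCommGroup X]
    [InnerProductSpace 𝕜 X] [CompleteSpace X] [NormedAddCommGroup X'] [InnerProductSpace 𝕜 X']
    (U : X ≃ₗᵢ[𝕜] X') (K : Submodule 𝕜 X) (hK : IsClosed (K : Set X)) :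
    hilbertDim 𝕜 (K.map U.toLinearEquiv.toLinearMap) = hilbertDim 𝕜 K := by
  have : CompleteSpace K := hK.completeSpace_coe
  have e := U.submoduleMap K
  have : CompleteSpace (K.map U.toLinearEquiv.toLinearMap) :=
    (completeSpace_congr (e := e.toEquiv) e.isometry.isUniformEmbedding).1 this
  exact hilbertDim_eq_iff.2 ⟨e.symm⟩

theorem UnitarilyEquivalentPairs.equivalentlyPositioned {X X' : Type u} [NormedAddCommGroup X]
    [InnerProductSpace 𝕜 X] [CompleteSpace X] [NormedAddCommGroup X'] [InnerProductSpace 𝕜 X']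
    {M N : Submodule 𝕜 X} (hM : IsClosed (M : Set X)) (hN : IsClosed (N : Set X))
    {M' N' : Submodule 𝕜 X'} (h : UnitarilyEquivalentPairs M N M' N')
    (h' : EquivalentlyPositioned M' N') : EquivalentlyPositioned M N := by
  obtain ⟨U, h⟩ := h
  have h'' : EquivalentlyPositioned (M.map U.toLinearEquiv.toLinearMap)
      (N.map U.toLinearEquiv.toLinearMap) := by
    rcases h with ⟨h1, h2⟩ | ⟨h1, h2⟩ <;> rw [h1, h2]
    exacts [h', h'.symm]
  unfold EquivalentlyPositioned at h'' ⊢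
  rwa [inf_comm (M.map _)ᗮ, ← Submodule.map_inf_orthogonal_linearIsometryEquiv,
    ← Submodule.map_inf_orthogonal_linearIsometryEquiv,
    Submodule.hilbertDim_map_linearIsometryEquiv _ _ (hM.inter N.isClosed_orthogonal),
    Submodule.hilbertDim_map_linearIsometryEquiv _ _ (hN.inter M.isClosed_orthogonal),
    inf_comm N] at h''

/-- The reflection `(x, y) ↦ (x, -y)` exchanges the two graphs, hence carries one intersection onto
the other. -/
theorem equivalentlyPositioned_hilbertGraph {E F : Type u} [NormedAddCommGroup E]
    [InnerProductSpace 𝕜 E] [CompleteSpace E] [NormedAddCommGroup F] [InnerProductSpace 𝕜 F]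
    [CompleteSpace F] (T : E →L[𝕜] F) :
    EquivalentlyPositioned (-T).hilbertGraph T.hilbertGraph := by
  let D : WithLp 2 (E × F) ≃ₗᵢ[𝕜] WithLp 2 (E × F) :=
    LinearIsometryEquiv.withLpProdCongr 2 (LinearIsometryEquiv.refl 𝕜 E)
      (LinearIsometryEquiv.neg 𝕜)
  have hclosed : ∀ R : E →L[𝕜] F, IsClosed (R.hilbertGraph : Set (WithLp 2 (E × F))) := fun R =>
    isClosed_eq (WithLp.continuous_snd 2 _ _) (R.continuous.comp (WithLp.continuous_fst 2 _ _))
  have hD : ∀ R : E →L[𝕜] F,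
      R.hilbertGraph.map D.toLinearEquiv.toLinearMap = (-R).hilbertGraph := by
    intro R
    ext w
    constructor
    · rintro ⟨v, hv, rfl⟩
      have hv : v.snd = R v.fst := hv
      change -v.snd = -R v.fst
      rw [hv]
    · intro hw
      have hw : w.snd = -R w.fst := hw
      refine ⟨WithLp.toLp 2 (w.fst, -w.snd), ?_, ?_⟩
      · change -w.snd = R w.fst
        rw [hw, neg_neg]
      · exact WithLp.ofLp_injective 2 (Prod.ext rfl (neg_neg w.snd))
  unfold EquivalentlyPositioned
  rw [← Submodule.hilbertDim_map_linearIsometryEquiv D _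
      ((hclosed (-T)).inter T.hilbertGraph.isClosed_orthogonal),
    Submodule.map_inf_orthogonal_linearIsometryEquiv, hD, hD, neg_neg, inf_comm]

end Equivalence

/-! ### Construction of the operators -/

section Constructions

variable {𝕜 : Type*} [RCLike 𝕜] {X : Type u} [NormedAddCommGroup X] [InnerProductSpace 𝕜 X]
  [CompleteSpace X]

open Submodule

/-- A subspace `M` on which the form of a symmetry `J` is nonnegative, and maximal with that
property, is the graph of a contraction between the eigenspaces of `J`. -/
theorem exists_contraction_of_symmetry {M N : Submodule 𝕜 X} (hM : IsClosed (M : Set X))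
    {J : X →L[𝕜] X} (hJ : IsSelfAdjoint J) (hJJ : J * J = 1) (hMN : ∀ x, J x ∈ N ↔ x ∈ M)
    (hpos : ∀ x ∈ M, 0 ≤ RCLike.re (inner 𝕜 (J x) x))
    (hmax : ∀ y, y ∈ Mᗮ → y ∈ Nᗮ → J y = y → y = 0) :
    ∃ (X₁ X₂ : Type u)
      (_ : NormedAddCommGroup X₁) (_ : InnerProductSpace 𝕜 X₁) (_ : CompleteSpace X₁)
      (_ : NormedAddCommGroup X₂) (_ : InnerProductSpace 𝕜 X₂) (_ : CompleteSpace X₂)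
      (T : X₁ →L[𝕜] X₂), ‖T‖ ≤ 1 ∧
        UnitarilyEquivalentPairs M N (-T).hilbertGraph T.hilbertGraph := by
  have hJ2 : ∀ x, J (J x) = x := fun x => DFunLike.congr_fun hJJ x
  let G : Submodule 𝕜 X := (J - 1).ker
  have hG : ∀ x, x ∈ G ↔ J x = x := fun x => by
    change J x - x = 0 ↔ _
    rw [sub_eq_zero]
  have hGc : CompleteSpace G := (ContinuousLinearMap.isClosed_ker (J - 1)).completeSpace_coe
  have hMc : CompleteSpace M := hM.completeSpace_coe
  have hG' : ∀ y ∈ Gᗮ, J y = -y := by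
    intro y hy
    have h1 : J y + y ∈ G := by rw [hG, map_add, hJ2, add_comm]
    have h2 : J y + y ∈ Gᗮ := by
      refine Gᗮ.add_mem ((mem_orthogonal _ _).2 fun u hu => ?_) hy
      rw [← hJ.inner_left_eq, (hG u).1 hu]
      exact (mem_orthogonal _ _).1 hy u hu
    have h3 : J y + y = 0 := (mem_bot 𝕜).1 (G.inf_orthogonal_eq_bot ▸ mem_inf.2 ⟨h1, h2⟩)
    exact eq_neg_of_add_eq_zero_left h3
  let p₁ := G.orthogonalProjectionOnto
  let p₂ := Gᗮ.orthogonalProjectionOnto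
  have hsum : ∀ x, x = (p₁ x : X) + (p₂ x : X) := fun x =>
    (G.starProjection_add_starProjection_orthogonal x).symm
  have hJx : ∀ x, J x = (p₁ x : X) - (p₂ x : X) := fun x => by
    conv_lhs => rw [hsum x, map_add, (hG _).1 (p₁ x).2, hG' _ (p₂ x).2, ← sub_eq_add_neg]
  have h12 : ∀ (a : G) (b : Gᗮ), inner 𝕜 (a : X) (b : X) = 0 := fun a b =>
    inner_right_of_mem_orthogonal a.2 b.2
  have h21 : ∀ (a : G) (b : Gᗮ), inner 𝕜 (b : X) (a : X) = 0 := fun a b =>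
    inner_left_of_mem_orthogonal a.2 b.2
  have hp₁ : ∀ (a : G) (b : Gᗮ), p₁ ((a : X) + b) = a := fun a b => by
    rw [map_add, orthogonalProjectionOnto_mem_subspace_eq_self,
      orthogonalProjectionOnto_apply_of_mem_orthogonal b.2, add_zero]
  have hp₂ : ∀ (a : G) (b : Gᗮ), p₂ ((a : X) + b) = b := fun a b => by
    rw [map_add, orthogonalProjectionOnto_mem_subspace_eq_self,
      orthogonalProjectionOnto_orthogonal_apply_eq_zero a.2, zero_add]
  have hp₁J : ∀ x, p₁ (J x) = p₁ x := fun x => by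
    have := hp₁ (p₁ x) (-p₂ x)
    rwa [NegMemClass.coe_neg, ← sub_eq_add_neg, ← hJx] at this
  have hp₂J : ∀ x, p₂ (J x) = -p₂ x := fun x => by
    have := hp₂ (p₁ x) (-p₂ x)
    rwa [NegMemClass.coe_neg, ← sub_eq_add_neg, ← hJx] at this
  have hle : ∀ x ∈ M, ‖p₂ x‖ ≤ ‖p₁ x‖ := by
    intro x hx
    have h1 := hpos x hx
    have h2 : inner 𝕜 (J x) x = inner 𝕜 (p₁ x : X) (p₁ x : X) - inner 𝕜 (p₂ x : X) (p₂ x : X) := by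
      rw [hJx]
      conv_lhs => rw [hsum x, hp₁, hp₂]
      rw [inner_add_right, inner_sub_left, inner_sub_left, h12, h21]
      ring
    rw [h2, map_sub, inner_self_eq_norm_sq, inner_self_eq_norm_sq, sub_nonneg] at h1
    exact le_of_sq_le_sq h1 (norm_nonneg _)
  let f : M →L[𝕜] G := p₁ ∘L M.subtypeL
  -- On `M`, `‖x‖ ≤ ‖p₁ x‖ + ‖p₂ x‖ ≤ 2 ‖p₁ x‖`; this gives injectivity and closed range.
  have hanti : AntilipschitzWith 2 f := by
    refine ContinuousLinearMap.antilipschitz_of_bound f fun m => ?_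
    have h1 := norm_add_le (p₁ m : X) (p₂ m : X)
    rw [← hsum] at h1
    have h2 := hle m m.2
    have h3 : ‖m‖ = ‖(m : X)‖ := rfl
    have h4 : ‖f m‖ = ‖(p₁ m : X)‖ := rfl
    have h5 : ‖p₁ m‖ = ‖(p₁ m : X)‖ := rfl
    have h6 : ‖p₂ m‖ = ‖(p₂ m : X)‖ := rfl
    rw [h3, h4]
    push_cast
    linarith
  have hclosed : IsClosed (f.range : Set G) := hanti.isClosed_range f.uniformContinuous
  -- A vector of `G` orthogonal to the range is orthogonal to `M`, and, being fixed by `J`, also to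
  -- `N = J M`; `hmax` then kills it.
  have hrange : f.range = ⊤ := by
    have : CompleteSpace f.range := hclosed.completeSpace_coe
    rw [← orthogonal_eq_bot_iff, eq_bot_iff]
    intro y hy
    have hyM : (y : X) ∈ Mᗮ := by
      refine (mem_orthogonal _ _).2 fun u hu => ?_
      have h1 : inner 𝕜 (f ⟨u, hu⟩) y = 0 := (mem_orthogonal _ _).1 hy _ ⟨⟨u, hu⟩, rfl⟩
      rw [hsum u, inner_add_left, h21, add_zero]
      exact h1
    have hJy : J y = y := (hG y).1 y.2
    have hyN : (y : X) ∈ Nᗮ := by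
      refine (mem_orthogonal _ _).2 fun u hu => ?_
      rw [← hJy, ← hJ.inner_left_eq]
      exact (mem_orthogonal _ _).1 hyM _ ((hMN _).1 (by rwa [hJ2]))
    exact (mem_bot 𝕜).2 (Subtype.ext (hmax y hyM hyN hJy))
  let e : M ≃ₗ[𝕜] G := LinearEquiv.ofBijective f.toLinearMap
    ⟨hanti.injective, LinearMap.range_eq_top.1 hrange⟩
  have he : ∀ a, p₁ (e.symm a : X) = a := fun a => e.apply_symm_apply a
  let T : G →L[𝕜] Gᗮ := LinearMap.mkContinuous
    (p₂.toLinearMap ∘ₗ M.subtype ∘ₗ e.symm.toLinearMap) 1 fun a => by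
      rw [one_mul]
      have := hle _ (e.symm a).2
      rwa [he] at this
  have hT : ∀ a, T a = p₂ (e.symm a : X) := fun a => rfl
  have hTM : ∀ x ∈ M, T (p₁ x) = p₂ x := fun x hx => by
    have : e.symm (p₁ x) = ⟨x, hx⟩ := e.symm_apply_apply ⟨x, hx⟩
    rw [hT, this]
  let U := G.orthogonalDecomposition
  have hU : ∀ x, U x = WithLp.toLp 2 (p₁ x, p₂ x) := fun x => G.orthogonalDecomposition_apply x
  -- `M` becomes the graph of `T` and `N` that of `-T`, hence the swapped alternative.
  refine ⟨G, Gᗮ, inferInstance, inferInstance, inferInstance, inferInstance, inferInstance,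
    inferInstance, T, LinearMap.mkContinuous_norm_le _ zero_le_one _, U, Or.inr ⟨?_, ?_⟩⟩
  · ext w
    rw [ContinuousLinearMap.mem_hilbertGraph]
    constructor
    · rintro ⟨x, hx, rfl⟩
      change (U x).snd = T (U x).fst
      rw [hU]
      exact (hTM x hx).symm
    · intro hw
      refine ⟨e.symm w.fst, (e.symm w.fst).2, ?_⟩
      change U _ = w
      rw [hU, he, ← hT, ← hw]
      rfl
  · ext w
    rw [ContinuousLinearMap.mem_hilbertGraph]
    constructor
    · rintro ⟨x, hx, rfl⟩
      change (U x).snd = -T (U x).fst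
      rw [hU]
      change p₂ x = -T (p₁ x)
      rw [← hp₁J, hTM _ ((hMN _).1 (by rwa [hJ2])), hp₂J, neg_neg]
    · intro hw
      have hw : w.snd = -T w.fst := hw
      refine ⟨J (e.symm w.fst), (hMN _).2 (e.symm w.fst).2, ?_⟩
      change U _ = w
      rw [hU, hp₁J, hp₂J, he, ← hT, ← hw]
      rfl

/-- Equivalently positioned subspaces are graphs of `T` and `-T` for a contraction `T`. -/
theorem EquivalentlyPositioned.exists_contraction {M N : Submodule 𝕜 X}
    (hM : IsClosed (M : Set X)) (hN : IsClosed (N : Set X)) (h : EquivalentlyPositioned M N) :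
    ∃ (X₁ X₂ : Type u)
      (_ : NormedAddCommGroup X₁) (_ : InnerProductSpace 𝕜 X₁) (_ : CompleteSpace X₁)
      (_ : NormedAddCommGroup X₂) (_ : InnerProductSpace 𝕜 X₂) (_ : CompleteSpace X₂)
      (T : X₁ →L[𝕜] X₂), ‖T‖ ≤ 1 ∧
        UnitarilyEquivalentPairs M N (-T).hilbertGraph T.hilbertGraph := by
  have : CompleteSpace M := hM.completeSpace_coe
  have : CompleteSpace N := hN.completeSpace_coe
  have : CompleteSpace ↥(M ⊓ Nᗮ) := (hM.inter N.isClosed_orthogonal).completeSpace_coe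
  have : CompleteSpace ↥(Mᗮ ⊓ N) := (M.isClosed_orthogonal.inter hN).completeSpace_coe
  obtain ⟨V⟩ := hilbertDim_eq_iff.1 h
  obtain ⟨J, hJ, hJJ, hPQ, hpos, hmax⟩ := exists_symmetry_exchanging M N V
  refine exists_contraction_of_symmetry hM hJ hJJ (fun x => ?_) hpos hmax
  have h1 : J (M.starProjection x) = N.starProjection (J x) := DFunLike.congr_fun hPQ x
  have hJ2 : Function.LeftInverse J J := fun x => DFunLike.congr_fun hJJ x
  rw [← starProjection_eq_self_iff, ← h1, hJ2.injective.eq_iff, starProjection_eq_self_iff]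

/-- Subspaces in position `p'` are the horizontal space and the graph of a closed operator. -/
theorem InPositionPPrime.exists_closed_operator {M N : Submodule 𝕜 X}
    (hM : IsClosed (M : Set X)) (hN : IsClosed (N : Set X)) (h : InPositionPPrime M N) :
    ∃ (Y₁ Y₂ : Type u)
      (_ : NormedAddCommGroup Y₁) (_ : InnerProductSpace 𝕜 Y₁) (_ : CompleteSpace Y₁)
      (_ : NormedAddCommGroup Y₂) (_ : InnerProductSpace 𝕜 Y₂) (_ : CompleteSpace Y₂)
      (S : Y₁ →ₗ.[𝕜] Y₂), Dense (S.domain : Set Y₁) ∧ S.IsClosed ∧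
        UnitarilyEquivalentPairs M N
          (Submodule.prod (⊤ : Submodule 𝕜 Y₁) (⊥ : Submodule 𝕜 Y₂)).inHilbertSum
          S.hilbertGraph := by
  have : CompleteSpace M := hM.completeSpace_coe
  let U := M.orthogonalDecomposition
  have hU : ∀ x, U x = WithLp.toLp 2 (M.orthogonalProjectionOnto x,
    Mᗮ.orthogonalProjectionOnto x) := fun x => M.orthogonalDecomposition_apply x
  have hUs : ∀ w, U.symm w = (w.fst : X) + (w.snd : X) := fun w => rfl
  let g : Submodule 𝕜 (M × Mᗮ) :=
    N.comap (U.symm.toLinearEquiv.toLinearMap ∘ₗ (WithLp.linearEquiv 2 𝕜 (M × Mᗮ)).symm.toLinearMap)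
  have hg : ∀ w : M × Mᗮ, w ∈ g ↔ (w.1 : X) + (w.2 : X) ∈ N := fun w => Iff.rfl
  -- Single-valuedness is `Mᗮ ⊓ N = ⊥`.
  have hg0 : ∀ w ∈ g, w.1 = 0 → w.2 = 0 := by
    intro w hw h0
    rw [hg, h0, ZeroMemClass.coe_zero, zero_add] at hw
    have : (w.2 : X) ∈ Mᗮ ⊓ N := ⟨w.2.2, hw⟩
    rw [h.2, mem_bot] at this
    exact Subtype.ext this
  have hgraph := g.toLinearPMap_graph_eq hg0
  refine ⟨M, Mᗮ, inferInstance, inferInstance, inferInstance, inferInstance, inferInstance,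
    inferInstance, g.toLinearPMap, ?_, ?_, U, Or.inl ⟨?_, ?_⟩⟩
  · rw [g.toLinearPMap_domain, dense_iff_topologicalClosure_eq_top, topologicalClosure_eq_top_iff,
      eq_bot_iff]
    intro y hy
    -- The domain is the projection of `N` to `M`, so a vector of `M` orthogonal to it is orthogonal
    -- to `N`.
    have hy2 : (y : X) ∈ M ⊓ Nᗮ := by
      refine ⟨y.2, (mem_orthogonal _ _).2 fun n hn => ?_⟩
      have e : (M.orthogonalProjectionOnto n : X) + (Mᗮ.orthogonalProjectionOnto n : X) = n :=
        M.starProjection_add_starProjection_orthogonal n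
      have h1 : inner 𝕜 (M.orthogonalProjectionOnto n) y = 0 :=
        (mem_orthogonal _ _).1 hy _ ⟨(M.orthogonalProjectionOnto n, Mᗮ.orthogonalProjectionOnto n),
          (hg _).2 (by rwa [e]), rfl⟩
      rw [← e, inner_add_left,
        inner_left_of_mem_orthogonal y.2 (Mᗮ.orthogonalProjectionOnto n).2, add_zero]
      exact h1
    rw [h.1, mem_bot] at hy2
    exact (mem_bot 𝕜).2 (Subtype.ext hy2)
  · unfold LinearPMap.IsClosed
    rw [hgraph]
    exact hN.preimage (by fun_prop : Continuous fun w : M × Mᗮ => (w.1 : X) + (w.2 : X))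
  · ext w
    constructor
    · rintro ⟨x, hx, rfl⟩
      refine ⟨trivial, ?_⟩
      change (U x).snd = 0
      rw [hU]
      exact orthogonalProjectionOnto_orthogonal_apply_eq_zero hx
    · rintro ⟨-, hw⟩
      replace hw : w.snd = 0 := hw
      refine ⟨U.symm w, ?_, U.apply_symm_apply w⟩
      rw [hUs, hw, ZeroMemClass.coe_zero, add_zero]
      exact w.fst.2
  · ext w
    rw [LinearPMap.mem_hilbertGraph, hgraph, hg, ← hUs]
    constructor
    · rintro ⟨x, hx, rfl⟩
      exact (U.symm_apply_apply x).symm ▸ hx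
    · intro hw
      exact ⟨U.symm w, hw, U.apply_symm_apply w⟩

end Constructions

/-! ### The main theorem -/

theorem proposition4p1 {𝕜 : Type*} [RCLike 𝕜] {X : Type u} [NormedAddCommGroup X]
    [InnerProductSpace 𝕜 X] [CompleteSpace X] (M N : Submodule 𝕜 X)
    (hM : IsClosed (M : Set X)) (hN : IsClosed (N : Set X)) :
    ((InPositionPPrime M N ↔
        ∃ (X₁ X₂ : Type u)
          (_ : NormedAddCommGroup X₁) (_ : InnerProductSpace 𝕜 X₁) (_ : CompleteSpace X₁)
          (_ : NormedAddCommGroup X₂) (_ : InnerProductSpace 𝕜 X₂) (_ : CompleteSpace X₂)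
          (T : X₁ →L[𝕜] X₂), ‖T‖ ≤ 1 ∧
            Function.Injective
              (ContinuousLinearMap.id 𝕜 X₁ - ContinuousLinearMap.adjoint T ∘L T) ∧
            UnitarilyEquivalentPairs M N (-T).hilbertGraph T.hilbertGraph) ∧
      (InPositionPPrime M N ↔
        ∃ (Y₁ Y₂ : Type u)
          (_ : NormedAddCommGroup Y₁) (_ : InnerProductSpace 𝕜 Y₁) (_ : CompleteSpace Y₁)
          (_ : NormedAddCommGroup Y₂) (_ : InnerProductSpace 𝕜 Y₂) (_ : CompleteSpace Y₂)
          (S : Y₁ →ₗ.[𝕜] Y₂), Dense (S.domain : Set Y₁) ∧ S.IsClosed ∧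
            UnitarilyEquivalentPairs M N
              (Submodule.prod (⊤ : Submodule 𝕜 Y₁) (⊥ : Submodule 𝕜 Y₂)).inHilbertSum
              S.hilbertGraph)) ∧
    (EquivalentlyPositioned M N ↔
      ∃ (X₁ X₂ : Type u)
        (_ : NormedAddCommGroup X₁) (_ : InnerProductSpace 𝕜 X₁) (_ : CompleteSpace X₁)
        (_ : NormedAddCommGroup X₂) (_ : InnerProductSpace 𝕜 X₂) (_ : CompleteSpace X₂)
        (T : X₁ →L[𝕜] X₂), ‖T‖ ≤ 1 ∧
          UnitarilyEquivalentPairs M N (-T).hilbertGraph T.hilbertGraph) := by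
  refine ⟨⟨⟨fun h => ?_, ?_⟩, ⟨fun h => h.exists_closed_operator hM hN, ?_⟩⟩,
    ⟨fun h => h.exists_contraction hM hN, ?_⟩⟩
  · obtain ⟨X₁, X₂, _, _, _, _, _, _, T, hT, hU⟩ :=
      h.equivalentlyPositioned.exists_contraction hM hN
    exact ⟨X₁, X₂, _, _, _, _, _, _, T, hT,
      (inPositionPPrime_hilbertGraph_iff T).1 (hU.inPositionPPrime_iff.1 h), hU⟩
  · rintro ⟨X₁, X₂, _, _, _, _, _, _, T, -, hT, hU⟩
    exact hU.inPositionPPrime_iff.2 ((inPositionPPrime_hilbertGraph_iff T).2 hT)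
  · rintro ⟨Y₁, Y₂, _, _, _, _, _, _, S, hS, -, hU⟩
    exact hU.inPositionPPrime_iff.2 (inPositionPPrime_prod_top_bot_hilbertGraph hS)
  · rintro ⟨X₁, X₂, _, _, _, _, _, _, T, -, hU⟩
    exact hU.equivalentlyPositioned hM hN (equivalentlyPositioned_hilbertGraph T)
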